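/- Let $M$ be the sphere, the Euclidean plane or the hyperbolic plane of constant curvature $k$ (that is, $\mathbb S^2$, $\mathbb E^2$, $\mathbb H^2$ for $k>0$, $k=0$, $k<0$), and let $L(r)$, $A(r)$, $c(r)$ be the circumference, the area and the geodesic curvature of a circle of radius $r$ in $M$, extended to $r<0$ by $L(-r)=-L(r)$, $c(-r)=-c(r)$, $A(-r)=A(r)$. Put $\ell(r)=L(r)/2\pi$ and $a(r)=A(r)/2\pi$; the product $\ell(r)c(r)$ is given its limit value $1$ at $r=0$. Let $O\in M$ be an origin with a fixed axis from which central angles are measured, and let $K\subset M$ be a convex body (compact, with nonempty interior) with $C^2$ boundary; if $k>0$, assume that $K$ lies in the open hemisphere centered at $O$. Let $s$ be arclength on $\partial K$ in the positive (counterclockwise) direction. For a point $P\in\partial K$ let $F$ be the point closest to $O$ on the support line of $K$ through $P$. Let $(r,\omega)$ be signed polar coordinates of $F$, so that $|r|$ is the distance from $O$ to the support line and $\omega$ is a central angle perpendicular to the support line; the sign of $r$, and $\omega$ when $r=0$, are determined by requiring that the radial geodesic with central angle $\omega$ crosses the support line at $F$ in the direction of the outward normal. Here $\omega$ is chosen to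 be a continuous function of $s$. Let $x$ be the (signed, with either sign) length of the third side $FP$ of the right triangle $OFP$, whose hypotenuse is the radial segment $OP$ and whose other leg is $OF$. Theorem 5.1. The function $\omega$ is differentiable in $s$, the numbers $\ell(x)c(x)$ and $1-k\,a(x)$ are nonzero, and the geodesic curvature of $\partial K$ is $$\kappa_g=\frac{\ell(r)c(r)}{\ell(x)c(x)}\,\frac{d\omega}{ds}=\frac{1-k\,a(r)}{1-k\,a(x)}\,\frac{d\omega}{ds}.$$ In particular $\kappa_g=\dfrac{\cos r}{\cos x}\dfrac{d\omega}{ds}$ for $k=1$, $\kappa_g=\dfrac{\cosh r}{\cosh x}\dfrac{d\omega}{ds}$ for $k=-1$, and $\kappa_g=\dfrac{d\omega}{ds}$ for $k=0$. -/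

import Mathlib

open Real Filter Topology

noncomputable section

namespace ConstCurv

/-! ## The plane of constant curvature `k`

For `k ≠ 0` the complete simply connected surface of curvature `k` is a sphere of radius `1 / √k`,
respectively one sheet of a two-sheeted hyperboloid, in a (pseudo-)Euclidean space of dimension 3.
With the first coordinate rescaled by `√|k|`, this is the quadric `p₀² + k (p₁² + p₂²) = 1` with
the metric `dp₀² / k + dp₁² + dp₂²`; for `k = 0` the same equation gives the affine plane
`p₀ = 1`, on which `dp₀ = 0`, so the metric is `dp₁² + dp₂²`. -/

/-- The plane of constant curvature `k`: a sphere if `k > 0`, the Euclidean plane if `k = 0`,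
a hyperbolic plane if `k < 0`. -/
def CurvPlane (k : ℝ) : Type :=
  {p : Fin 3 → ℝ // p 0 ^ 2 + k * (p 1 ^ 2 + p 2 ^ 2) = 1 ∧ (k ≤ 0 → 0 < p 0)}

instance (k : ℝ) : TopologicalSpace (CurvPlane k) :=
  inferInstanceAs (TopologicalSpace
    {p : Fin 3 → ℝ // p 0 ^ 2 + k * (p 1 ^ 2 + p 2 ^ 2) = 1 ∧ (k ≤ 0 → 0 < p 0)})

/-- The vector of ambient coordinates of a point. -/
def CurvPlane.coord {k : ℝ} (p : CurvPlane k) : Fin 3 → ℝ := p.1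

/-- The Riemannian metric on tangent vectors. For `k = 0` tangent vectors have `v 0 = 0`, and the
last summand is zero. -/
def metric (k : ℝ) (v w : Fin 3 → ℝ) : ℝ := v 1 * w 1 + v 2 * w 2 + v 0 * w 0 / k

/-- `v` is tangent to the plane of curvature `k` at the point with coordinates `p`. -/
def IsTangent (k : ℝ) (p v : Fin 3 → ℝ) : Prop := p 0 * v 0 + k * (p 1 * v 1 + p 2 * v 2) = 0

/-- `v` is a unit tangent vector at `p`. -/
def IsUnitTangent (k : ℝ) (p v : Fin 3 → ℝ) : Prop := IsTangent k p v ∧ metric k v v = 1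

/-- Projection of an ambient vector to the tangent plane at `p` along the normal vector `p`. -/
def tangentProj (k : ℝ) (p v : Fin 3 → ℝ) : Fin 3 → ℝ :=
  v - (p 0 * v 0 + k * (p 1 * v 1 + p 2 * v 2)) • p

/-- Counterclockwise rotation by `π / 2` in the tangent plane at `p`: the tangent vector
`w = rot k p v` has `metric k w u = det (p, v, u)` for all tangent vectors `u`. -/
def rot (k : ℝ) (p v : Fin 3 → ℝ) : Fin 3 → ℝ :=
  ![k * (p 1 * v 2 - p 2 * v 1), p 2 * v 0 - p 0 * v 2, p 0 * v 1 - p 1 * v 0]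

/-- The geodesic curvature `⟨∇_T T, T_⊥⟩` of a curve `c` parametrized by arclength. Here `T = c'`,
the covariant derivative `∇_T T` is the tangential part of `c''`, and `T_⊥` is the
counterclockwise rotation of `T` by `π / 2`. -/
def geodesicCurvature (k : ℝ) (c : ℝ → Fin 3 → ℝ) (s : ℝ) : ℝ :=
  metric k (tangentProj k (c s) (deriv (deriv c) s)) (rot k (c s) (deriv c s))

/-! ## Geodesics, distance, polar coordinates -/

/-- The generalized cosine: `y'' + k y = 0`, `y 0 = 1`, `y' 0 = 0`. -/
def cs (k t : ℝ) : ℝ :=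
  if 0 < k then cos (√k * t) else if k = 0 then 1 else cosh (√(-k) * t)

/-- The generalized sine: `y'' + k y = 0`, `y 0 = 0`, `y' 0 = 1`. -/
def sn (k t : ℝ) : ℝ :=
  if 0 < k then sin (√k * t) / √k else if k = 0 then t else sinh (√(-k) * t) / √(-k)

/-- The unit speed geodesic with initial point `p` and initial (unit tangent) velocity `v`: it is
the solution of `c'' + k c = 0`, `c 0 = p`, `c' 0 = v`. -/
def geod (k : ℝ) (p v : Fin 3 → ℝ) (t : ℝ) : Fin 3 → ℝ := cs k t • p + sn k t • v

/-- The Riemannian distance: the length of a shortest geodesic from `p` to `q`. -/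
def geodDist (k : ℝ) (p q : Fin 3 → ℝ) : ℝ :=
  sInf {t : ℝ | 0 ≤ t ∧ ∃ v, IsUnitTangent k p v ∧ geod k p v t = q}

/-- The point with polar coordinates `(ρ, θ)`, for the origin `O` and the axis with direction `e`
(a unit tangent vector at `O`). For `ρ < 0` it is the point at distance `|ρ|` on the opposite
ray. -/
def polar (k : ℝ) (O e : Fin 3 → ℝ) (ρ θ : ℝ) : Fin 3 → ℝ :=
  geod k O (cos θ • e + sin θ • rot k O e) ρ

/-! ## Circumference, area and curvature of circles

All circles of the same radius are congruent; the following are computed for circles with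
center `(1, 0, 0)`. They are used for `k |r|² < π² / 4` only. -/

/-- Polar coordinates with origin `(1, 0, 0)` and axis `(0, 1, 0)`. -/
def stdPolar (k ρ θ : ℝ) : Fin 3 → ℝ := polar k ![1, 0, 0] ![0, 1, 0] ρ θ

/-- The circumference `L(r)` of a circle of radius `r`; `L(-r) = -L(r)`. -/
def circumference (k r : ℝ) : ℝ :=
  Real.sign r * ∫ θ in (0 : ℝ)..(2 * π),
    √(metric k (deriv (stdPolar k |r|) θ) (deriv (stdPolar k |r|) θ))

/-- The density of the Riemannian area in polar coordinates (square root of the Gram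
determinant of the coordinate vector fields). -/
def areaDensity (k ρ θ : ℝ) : ℝ :=
  let u := deriv (fun t => stdPolar k t θ) ρ
  let w := deriv (fun t => stdPolar k ρ t) θ
  √(metric k u u * metric k w w - metric k u w ^ 2)

/-- The area `A(r)` of a disk of radius `|r|`. -/
def diskArea (k r : ℝ) : ℝ :=
  ∫ ρ in (0 : ℝ)..|r|, ∫ θ in (0 : ℝ)..(2 * π), areaDensity k ρ θ

/-- `ℓ(r) = L(r) / 2π`. -/
def ell (k r : ℝ) : ℝ := circumference k r / (2 * π)

/-- `a(r) = A(r) / 2π`. -/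
def area (k r : ℝ) : ℝ := diskArea k r / (2 * π)

/-- The geodesic curvature `c(r)` of a circle of radius `r ≠ 0`, parametrized counterclockwise by
arclength; `c(-r) = -c(r)`. -/
def circleCurvature (k r : ℝ) : ℝ :=
  Real.sign r * geodesicCurvature k (fun s => stdPolar k |r| (s / ell k |r|)) 0

open Classical in
/-- The product `ℓ(r) c(r)`, with its limit value `1` at `r = 0` (where `c` is infinite). -/
def ellCurv (k r : ℝ) : ℝ := if r = 0 then 1 else ell k r * circleCurvature k r

/-! ## Convex bodies and their boundaries -/

/-- `K` is a convex body: compact, with nonempty interior, and containing every shortest geodesic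
segment between two of its points. -/
structure IsConvexBody {k : ℝ} (K : Set (CurvPlane k)) : Prop where
  isCompact : IsCompact K
  nonempty_interior : (interior K).Nonempty
  convex : ∀ p ∈ K, ∀ q ∈ K, ∀ v, IsUnitTangent k p.coord v →
    geod k p.coord v (geodDist k p.coord q.coord) = q.coord →
    ∀ t ∈ Set.Icc 0 (geodDist k p.coord q.coord),
      ∀ z : CurvPlane k, z.coord = geod k p.coord v t → z ∈ K

/-- `γ` is a `C²` parametrization by arclength of the boundary of `K`, in the positive direction:
the rotation of the velocity by `π / 2` counterclockwise points into `K`. -/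
structure IsPositiveBoundaryParam {k : ℝ} (K : Set (CurvPlane k)) (γ : ℝ → CurvPlane k) :
    Prop where
  contDiff : ContDiff ℝ 2 (fun s => (γ s).coord)
  range_eq : Set.range γ = frontier K
  unit_speed : ∀ s, metric k (deriv (fun s => (γ s).coord) s)
    (deriv (fun s => (γ s).coord) s) = 1
  positive : ∀ s, ∀ᶠ t in 𝓝[>] (0 : ℝ), ∃ z ∈ interior K,
    z.coord = geod k (γ s).coord
      (rot k (γ s).coord (deriv (fun s => (γ s).coord) s)) t

/-- The geodesic through `P` with (unit tangent) direction `v` is a support line of `K` at `P`,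
oriented so that `K` lies in the closed half-plane to the left of it. -/
def IsSupportDirection {k : ℝ} (K : Set (CurvPlane k)) (P : CurvPlane k) (v : Fin 3 → ℝ) : Prop :=
  IsUnitTangent k P.coord v ∧ P ∈ K ∧ ∀ q ∈ K, 0 ≤ Matrix.det ![P.coord, v, q.coord]

/-- `r`, `ω`, `x` are the data of the right triangle `O F P`, where `F` is the point closest to the
origin `O` on a support line of `K` at `P`: the point `F` has polar coordinates `(r, ω)` with
`|r| = d(O, F)`, and `|x| = d(F, P)`. The sign of `r` is fixed (and `ω` is defined when `r = 0`) by
the requirement that the radial geodesic with central angle `ω`, which crosses the support line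
perpendicularly at `F`, does so in the direction of the outward normal. Both signs are allowed
for `x`. -/
def IsSupportTriangle {k : ℝ} (O : CurvPlane k) (e : Fin 3 → ℝ) (K : Set (CurvPlane k))
    (P : CurvPlane k) (r ω x : ℝ) : Prop :=
  ∃ (v : Fin 3 → ℝ) (τ : ℝ), IsSupportDirection K P v ∧
    polar k O.coord e r ω = geod k P.coord v τ ∧
    (∀ t, geodDist k O.coord (geod k P.coord v τ) ≤ geodDist k O.coord (geod k P.coord v t)) ∧
    |r| = geodDist k O.coord (geod k P.coord v τ) ∧
    |x| = geodDist k (geod k P.coord v τ) P.coord ∧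
    deriv (fun t => polar k O.coord e t ω) r =
      -rot k (geod k P.coord v τ) (deriv (geod k P.coord v) τ)

end ConstCurv

end

open ConstCurv

namespace ConstCurv

/-! ## Generalized trigonometric functions -/

/-! The argument is carried out with vectors of the ambient 3-space, uniformly in `k`. Let `T` be
the velocity of the boundary curve and `N = rot k P T` its inner normal. The support line at `P` is
the geodesic along `T` (`IsSupportDirection.eq_deriv`), and the unit normal of a geodesic is a
constant ambient vector (`rot_geod`), so `N` is also the normal at `F`. With `u = cos ω • e + sin ω
• rot k O e`, the condition that the radial geodesic crosses at `F` in the outward direction becomes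
`-k sn r • O + cs r • u = -N`.

Pairing with `e` and `rot k O e` gives `cs r cos ω = -⟨N, e⟩` and `cs r sin ω = -⟨N, rot k O e⟩`.
The right sides are differentiable, with `N' = -κ T` (`rot_eq_neg_curvature_smul`), and `cs r > 0`.
A continuous angle is then differentiable (`hasDerivAt_angle`), with `cs r · ω' = κ ⟨T, rot k O u⟩`.
This last product is `det (O, u, T)`, and equals `cs x` because `(O, u)` and `(F, -N)` differ by a
unimodular change of basis. Hence `κ = (cs r / cs x) ω'`.

It remains to see that `cs x ≠ 0`, which on the sphere follows from Pythagoras, `cs d(O, P) = cs r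
cs x`, and the hemisphere hypothesis, and that `ℓ c` and `1 - k a` are both `cs` (`ellCurv_eq`,
`one_sub_area_eq`). -/

theorem cs_sq_add (k t : ℝ) : cs k t ^ 2 + k * sn k t ^ 2 = 1 := by
  unfold cs sn
  split_ifs with h h0
  · have := sq_sqrt h.le
    have h2 : √k ≠ 0 := (sqrt_pos.2 h).ne'
    rw [div_pow, this, mul_div_cancel₀ _ h.ne']
    exact cos_sq_add_sin_sq _
  · simp [h0]
  · have hk : 0 < -k := neg_pos.2 (lt_of_le_of_ne (not_lt.1 h) h0)
    have := sq_sqrt hk.le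
    rw [div_pow, this, ← neg_neg k, neg_mul, neg_neg, mul_div_cancel₀ _ hk.ne']
    linarith [cosh_sq_sub_sinh_sq (√(-k) * t)]

@[simp] theorem cs_zero (k : ℝ) : cs k 0 = 1 := by simp [cs]

@[simp] theorem sn_zero (k : ℝ) : sn k 0 = 0 := by simp [sn]

@[simp] theorem cs_neg (k t : ℝ) : cs k (-t) = cs k t := by simp [cs]

@[simp] theorem sn_neg (k t : ℝ) : sn k (-t) = -sn k t := by
  unfold sn; split_ifs <;> simp [neg_div]

@[simp] theorem cs_abs (k t : ℝ) : cs k |t| = cs k t := by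
  rcases abs_choice t with h | h <;> simp [h]

theorem hasDerivAt_cs (k t : ℝ) : HasDerivAt (cs k) (-k * sn k t) t := by
  unfold cs sn
  split_ifs with h h0
  · have h2 : √k ≠ 0 := (sqrt_pos.2 h).ne'
    have := (((hasDerivAt_id t).const_mul (√k)).cos)
    refine this.congr_deriv ?_
    simp only [id]
    field_simp
    rw [sq_sqrt h.le]
    ring
  · simpa [h0] using hasDerivAt_const t (1 : ℝ)
  · have hk : 0 < -k := neg_pos.2 (lt_of_le_of_ne (not_lt.1 h) h0)
    have h2 : √(-k) ≠ 0 := (sqrt_pos.2 hk).ne'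
    have := (((hasDerivAt_id t).const_mul (√(-k))).cosh)
    refine this.congr_deriv ?_
    simp only [id]
    field_simp
    rw [sq_sqrt hk.le]
    ring

theorem hasDerivAt_sn (k t : ℝ) : HasDerivAt (sn k) (cs k t) t := by
  unfold cs sn
  split_ifs with h h0
  · have h2 : √k ≠ 0 := (sqrt_pos.2 h).ne'
    refine ((((hasDerivAt_id t).const_mul (√k)).sin).div_const _).congr_deriv ?_
    simp only [id]
    field_simp
  · exact hasDerivAt_id t
  · have hk : 0 < -k := neg_pos.2 (lt_of_le_of_ne (not_lt.1 h) h0)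
    have h2 : √(-k) ≠ 0 := (sqrt_pos.2 hk).ne'
    refine ((((hasDerivAt_id t).const_mul (√(-k))).sinh).div_const _).congr_deriv ?_
    simp only [id]
    field_simp

theorem sn_pos {k t : ℝ} (ht : 0 < t) (hk : 0 < k → √k * t < π) : 0 < sn k t := by
  unfold sn
  split_ifs with h h0
  · have := sqrt_pos.2 h
    exact div_pos (sin_pos_of_pos_of_lt_pi (by positivity) (hk h)) this
  · exact ht
  · have hk : 0 < -k := neg_pos.2 (lt_of_le_of_ne (not_lt.1 h) h0)
    have := sqrt_pos.2 hk
    exact div_pos (sinh_pos_iff.2 (by positivity)) this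

theorem cs_pos {k t : ℝ} (hk : 0 < k → √k * |t| < π / 2) : 0 < cs k t := by
  rw [← cs_abs]
  unfold cs
  split_ifs with h h0
  · refine cos_pos_of_mem_Ioo ⟨?_, hk h⟩
    have : 0 ≤ √k * |t| := by positivity
    linarith [pi_pos]
  · exact one_pos
  · exact cosh_pos _

/-- `cs k` is injective up to the first half-period. -/
theorem le_of_cs_eq {k t t' : ℝ} (k0 : k ≠ 0) (hk : 0 < k → √k * t ≤ π)
    (ht' : 0 ≤ t') (h : cs k t = cs k t') : t ≤ t' := by
  by_contra! hlt
  unfold cs at h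
  split_ifs at h with h1
  · have := sqrt_pos.2 h1
    have := cos_lt_cos_of_nonneg_of_le_pi (x := √k * t') (y := √k * t) (by positivity) (hk h1)
      (by gcongr)
    linarith
  · have hk : 0 < -k := neg_pos.2 (lt_of_le_of_ne (not_lt.1 h1) k0)
    have h2 := sqrt_pos.2 hk
    have h3 : √(-k) * t' < √(-k) * t := by gcongr
    have h4 : 0 ≤ √(-k) * t' := by positivity
    have := cosh_lt_cosh.2 (show |√(-k) * t'| < |√(-k) * t| by
      rwa [abs_of_nonneg h4, abs_of_nonneg (h4.trans h3.le)])
    linarith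

/-- A geodesic parameter on the sphere is not bounded. Subtracting the nearest multiple of the
period `2π / √k` brings it into the range where its absolute value is a distance. -/
theorem exists_period_shift (k t : ℝ) :
    ∃ t', cs k t' = cs k t ∧ sn k t' = sn k t ∧ (0 < k → √k * |t'| ≤ π) := by
  by_cases h : 0 < k
  · have h2 := sqrt_pos.2 h
    set n := round (√k * t / (2 * π)) with hn
    have hsub : √k * (t - n * (2 * π) / √k) = √k * t - n * (2 * π) := by field_simp
    refine ⟨t - n * (2 * π) / √k, ?_, ?_, fun _ => ?_⟩
    · simp only [cs, if_pos h, hsub, cos_sub_int_mul_two_pi]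
    · simp only [sn, if_pos h, hsub, sin_sub_int_mul_two_pi]
    · have h3 := abs_sub_round (√k * t / (2 * π))
      rw [← hn] at h3
      have h4 : √k * |t - n * (2 * π) / √k| = |√k * t / (2 * π) - n| * (2 * π) := by
        rw [← abs_of_pos h2, ← abs_mul, abs_of_pos h2, hsub]
        nth_rewrite 3 [← abs_of_pos two_pi_pos]
        rw [← abs_mul]
        congr 1
        field_simp
      rw [h4]
      nlinarith [pi_pos]
  · exact ⟨t, rfl, rfl, fun h' => absurd h' h⟩

theorem lt_of_cs_pos {k t : ℝ} (hk : 0 < k) (ht : √k * |t| ≤ π) (h : 0 < cs k t) :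
    √k * |t| < π / 2 := by
  by_contra! hle
  rw [← cs_abs, cs, if_pos hk] at h
  exact absurd h (cos_nonpos_of_pi_div_two_le_of_le hle (by linarith [pi_pos])).not_gt

/-! ## Algebra of the ambient space -/

/-- The determinant of three vectors. -/
def tripleProd (a b c : Fin 3 → ℝ) : ℝ :=
  a 0 * (b 1 * c 2 - b 2 * c 1) - a 1 * (b 0 * c 2 - b 2 * c 0) + a 2 * (b 0 * c 1 - b 1 * c 0)

theorem det_eq_tripleProd (a b c : Fin 3 → ℝ) : Matrix.det ![a, b, c] = tripleProd a b c := by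
  refine (Matrix.det_fin_three _).trans ?_
  simp [tripleProd]; ring

/-- The quadratic form whose unit quadric contains the plane of curvature `k`. -/
def form (k : ℝ) (p q : Fin 3 → ℝ) : ℝ := p 0 * q 0 + k * (p 1 * q 1 + p 2 * q 2)

theorem CurvPlane.form_self {k : ℝ} (p : CurvPlane k) : form k p.coord p.coord = 1 := by
  have := p.2.1
  simp only [form, CurvPlane.coord]
  linarith

section
variable {k : ℝ} {p v w y : Fin 3 → ℝ}

/-- At `k = 0` the summand `v 0 * w 0 / k` of `metric` is `0` by the convention for division by
zero, so `metric` ignores coordinate `0`. Tangent vectors lose nothing by this. -/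
theorem IsTangent.zero_of_curv_zero (hp : form k p p = 1) (hv : IsTangent k p v) (hk : k = 0) :
    v 0 = 0 := by
  subst hk
  simp only [form, IsTangent, zero_mul, add_zero] at hp hv
  rcases mul_eq_zero.1 hv with h | h
  · simp [h] at hp
  · exact h

theorem metric_rot (hv : k = 0 → w 0 = 0) : metric k (rot k p v) w = tripleProd p v w := by
  by_cases hk : k = 0
  · simp [metric, rot, tripleProd, hv hk, hk]; ring
  · simp [metric, rot, tripleProd]; field_simp; ring

theorem metric_eq_form (hk : k ≠ 0) : metric k v w = form k v w / k := by
  simp only [metric, form]; field_simp; ring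

/-- For `k ≠ 0` this is Lagrange's identity for cross products: `form p p * form v w - form p v *
form p w`, divided by `k`, where tangency kills the second product. -/
theorem tripleProd_rot (hp : form k p p = 1) (hv : IsTangent k p v) (hw : IsTangent k p w) :
    tripleProd p v (rot k p w) = metric k v w := by
  by_cases hk : k = 0
  · have h1 := hv.zero_of_curv_zero hp hk
    have h2 := hw.zero_of_curv_zero hp hk
    subst hk
    simp only [form, zero_mul, add_zero] at hp
    simp [tripleProd, rot, metric, h1, h2]
    linear_combination (v 1 * w 1 + v 2 * w 2) * hp
  · rw [metric_eq_form hk, eq_div_iff hk]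
    simp [tripleProd, rot, form, IsTangent] at *
    linear_combination (v 0 * w 0 + k * (v 1 * w 1 + v 2 * w 2)) * hp
      - (p 0 * w 0 + k * (p 1 * w 1 + p 2 * w 2)) * hv

theorem isTangent_rot : IsTangent k p (rot k p v) := by
  simp [IsTangent, rot]; ring

theorem metric_comm : metric k v w = metric k w v := by
  simp only [metric]; ring

theorem metric_add_left : metric k (v + y) w = metric k v w + metric k y w := by
  simp only [metric, Pi.add_apply]; ring

theorem metric_smul_left (c : ℝ) : metric k (c • v) w = c * metric k v w := by
  simp only [metric, Pi.smul_apply, smul_eq_mul]; ring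

theorem metric_neg_left : metric k (-v) w = -metric k v w := by
  simp only [metric, Pi.neg_apply]; ring

/-- Cramer's rule. -/
theorem tripleProd_smul (a b c x : Fin 3 → ℝ) :
    tripleProd a b c • x =
      tripleProd x b c • a + tripleProd a x c • b + tripleProd a b x • c := by
  ext i
  fin_cases i <;> simp [tripleProd] <;> ring

/-- Expansion of a tangent vector in a positive orthonormal frame. -/
theorem IsTangent.eq_frame (hp : form k p p = 1) (hv : IsUnitTangent k p v)
    (hw : IsTangent k p w) :
    w = metric k w v • v + tripleProd p v w • rot k p v := by
  have h := tripleProd_smul p v (rot k p v) w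
  rw [tripleProd_rot hp hv.1 hv.1, hv.2, one_smul, tripleProd_rot hp hw hv.1] at h
  -- Pairing Cramer's identity with `p` under `form` kills all tangent vectors and leaves only the
  -- coefficient of `p`.
  have h0 : tripleProd w v (rot k p v) = 0 := by
    have := congrArg (form k p) h
    have hv1 := hv.1
    simp only [IsTangent] at hw hv1
    have hr := isTangent_rot (k := k) (p := p) (v := v)
    simp only [IsTangent] at hr
    simp only [form, Pi.add_apply, Pi.smul_apply, smul_eq_mul] at this hp
    linear_combination -this + hw - tripleProd w v (rot k p v) * hp - metric k w v * hv1 -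
      tripleProd p v w * hr
  rw [h0, zero_smul, zero_add] at h
  exact h

theorem rot_rot (hp : form k p p = 1) (hv : IsTangent k p v) :
    rot k p (rot k p v) = -v := by
  simp only [form, IsTangent] at *
  ext i
  fin_cases i
  · simp [rot]; linear_combination (p 0) * hv - v 0 * hp
  · simp [rot]; linear_combination (p 1) * hv - v 1 * hp
  · simp [rot]; linear_combination (p 2) * hv - v 2 * hp

theorem IsUnitTangent.rot (hp : form k p p = 1) (hv : IsUnitTangent k p v) :
    IsUnitTangent k p (rot k p v) := by
  refine ⟨isTangent_rot, ?_⟩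
  rw [metric_rot fun hk => isTangent_rot.zero_of_curv_zero hp hk, tripleProd_rot hp hv.1 hv.1, hv.2]

theorem metric_rot_self (hp : form k p p = 1) (hv : IsTangent k p v) :
    metric k (rot k p v) v = 0 := by
  rw [metric_rot fun hk => hv.zero_of_curv_zero hp hk]
  simp only [tripleProd]; ring

/-- The frame equation `N' = -κ T`. -/
theorem rot_eq_neg_curvature_smul {d : Fin 3 → ℝ} (hp : form k p p = 1)
    (hv : IsUnitTangent k p v) (hd : k = 0 → d 0 = 0) (hdv : metric k d v = 0) :
    rot k p d = -metric k (tangentProj k p d) (rot k p v) • v := by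
  have hv0 := hv.1.zero_of_curv_zero hp
  have ht : IsTangent k p (tangentProj k p d) := by
    simp only [form] at hp
    simp only [IsTangent, tangentProj, Pi.sub_apply, Pi.smul_apply, smul_eq_mul]
    linear_combination -(p 0 * d 0 + k * (p 1 * d 1 + p 2 * d 2)) * hp
  have h1 : rot k p d = rot k p (tangentProj k p d) := by
    ext i
    fin_cases i <;> simp only [rot, tangentProj, Pi.sub_apply, Pi.smul_apply, smul_eq_mul,
      Fin.zero_eta, Fin.mk_one, Fin.reduceFinMk, Matrix.cons_val] <;> ring
  have h2 : metric k (tangentProj k p d) v = 0 := by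
    by_cases hk : k = 0
    · have := hd hk
      subst hk
      simpa [tangentProj, metric, this] using hdv
    · have h3 := hv.1
      simp only [IsTangent] at h3
      rw [← hdv]
      rw [metric_eq_form hk, metric_eq_form hk]
      congr 1
      simp only [form, tangentProj, Pi.sub_apply, Pi.smul_apply, smul_eq_mul]
      linear_combination -(p 0 * d 0 + k * (p 1 * d 1 + p 2 * d 2)) * h3
  -- The tangential part of `d` is orthogonal to `v`, hence a multiple of `rot k p v`; a second
  -- rotation turns it into a multiple of `-v`.
  have h4 := ht.eq_frame hp hv
  rw [h2, zero_smul, zero_add] at h4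
  rw [metric_comm, metric_rot (ht.zero_of_curv_zero hp), h1]
  nth_rewrite 1 [h4]
  rw [← neg_one_mul, mul_smul, smul_comm]
  have : ConstCurv.rot k p (tripleProd p v (tangentProj k p d) • ConstCurv.rot k p v)
      = tripleProd p v (tangentProj k p d) • ConstCurv.rot k p (ConstCurv.rot k p v) := by
    ext i
    fin_cases i <;> simp [ConstCurv.rot] <;> ring
  rw [this, rot_rot hp hv.1]
  simp

end

/-! ## Geodesics and distance -/

section
variable {k : ℝ} {p v : Fin 3 → ℝ}

theorem hasDerivAt_geod (k : ℝ) (p v : Fin 3 → ℝ) (t : ℝ) :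
    HasDerivAt (geod k p v) ((-k * sn k t) • p + cs k t • v) t :=
  ((hasDerivAt_cs k t).smul_const p).add ((hasDerivAt_sn k t).smul_const v)

@[simp] theorem geod_zero : geod k p v 0 = p := by simp [geod]

theorem form_geod_left (hp : form k p p = 1) (hv : IsTangent k p v) (t : ℝ) :
    form k p (geod k p v t) = cs k t := by
  simp only [form, IsTangent, geod, Pi.add_apply, Pi.smul_apply, smul_eq_mul] at *
  linear_combination cs k t * hp + sn k t * hv

theorem form_self_of_isUnitTangent (hp : form k p p = 1) (hv : IsUnitTangent k p v) :
    form k v v = k := by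
  by_cases hk : k = 0
  · have := hv.1.zero_of_curv_zero hp hk
    simp [form, hk, this]
  · have := hv.2
    rwa [metric_eq_form hk, div_eq_one_iff_eq hk] at this

theorem form_geod_self (hp : form k p p = 1) (hv : IsUnitTangent k p v) (t : ℝ) :
    form k (geod k p v t) (geod k p v t) = 1 := by
  have h1 := form_self_of_isUnitTangent hp hv
  have h2 := hv.1
  have h3 := cs_sq_add k t
  simp only [form, IsTangent, geod, Pi.add_apply, Pi.smul_apply, smul_eq_mul] at *
  linear_combination cs k t ^ 2 * hp + 2 * cs k t * sn k t * h2 + sn k t ^ 2 * h1 + h3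

theorem isUnitTangent_geod_velocity (hp : form k p p = 1) (hv : IsUnitTangent k p v) (t : ℝ) :
    IsUnitTangent k (geod k p v t) ((-k * sn k t) • p + cs k t • v) := by
  have h1 := form_self_of_isUnitTangent hp hv
  have h2 := hv.1
  have h3 := cs_sq_add k t
  constructor
  · simp only [form, IsTangent, geod, Pi.add_apply, Pi.smul_apply, smul_eq_mul] at *
    linear_combination (-k * cs k t * sn k t) * hp + (cs k t ^ 2 - k * sn k t ^ 2) * h2 +
      (sn k t * cs k t) * h1
  · by_cases hk : k = 0
    · have h4 := hv.2
      subst hk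
      simp only [metric, div_zero, add_zero] at h4
      simp [metric, cs]
      exact h4
    · rw [metric_eq_form hk, div_eq_one_iff_eq hk]
      simp only [form, IsTangent, Pi.add_apply, Pi.smul_apply, smul_eq_mul] at *
      linear_combination (k * sn k t) ^ 2 * hp - (2 * k * cs k t * sn k t) * h2 +
        (cs k t ^ 2) * h1 + k * h3

/-- `rot k p v` is bilinear and alternating in `(p, v)`, and moving along the geodesic changes this
pair by a matrix of determinant `cs ^ 2 + k * sn ^ 2 = 1`. -/
theorem rot_geod (t : ℝ) :
    rot k (geod k p v t) ((-k * sn k t) • p + cs k t • v) = rot k p v := by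
  have h3 := cs_sq_add k t
  ext i
  fin_cases i <;> simp only [rot, geod, Pi.add_apply, Pi.smul_apply, smul_eq_mul,
      Fin.zero_eta, Fin.mk_one, Fin.reduceFinMk, Matrix.cons_val]
  · linear_combination (k * (p 1 * v 2 - p 2 * v 1)) * h3
  · linear_combination (p 2 * v 0 - p 0 * v 2) * h3
  · linear_combination (p 0 * v 1 - p 1 * v 0) * h3

theorem geod_geod_neg (t : ℝ) :
    geod k (geod k p v t) ((-k * sn k t) • p + cs k t • v) (-t) = p := by
  have h3 := cs_sq_add k t
  ext i
  simp only [geod, Pi.add_apply, Pi.smul_apply, smul_eq_mul, cs_neg, sn_neg]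
  linear_combination p i * h3

theorem geod_neg (t : ℝ) : geod k p (-v) t = geod k p v (-t) := by
  simp [geod]

theorem IsUnitTangent.neg (hv : IsUnitTangent k p v) : IsUnitTangent k p (-v) := by
  refine ⟨?_, ?_⟩
  · have := hv.1
    simp only [IsTangent, Pi.neg_apply] at *
    linarith
  · have := hv.2
    simp only [metric, Pi.neg_apply] at *
    rw [← this]; ring

theorem geodDist_geod_of_nonneg (hp : form k p p = 1) (hv : IsUnitTangent k p v) {t : ℝ}
    (ht : 0 ≤ t) (hk : 0 < k → √k * t ≤ π) : geodDist k p (geod k p v t) = t := by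
  refine IsLeast.csInf_eq ⟨⟨ht, v, hv, rfl⟩, ?_⟩
  rintro t' ⟨ht', v', hv', h⟩
  -- In the flat case `cs` is constant and carries no information, so lengths of displacements are
  -- compared. Otherwise `form k p q = cs k t` determines the distance.
  by_cases k0 : k = 0
  · subst k0
    have h1 := hv.2
    have h2 := hv'.2
    have e1 := congrFun h 1
    have e2 := congrFun h 2
    simp [geod, cs, sn] at e1 e2
    simp only [metric, div_zero, add_zero] at h1 h2
    refine le_of_sq_le_sq ?_ ht'
    have : t' ^ 2 = t ^ 2 := by
      calc t' ^ 2 = (t' * v' 1) ^ 2 + (t' * v' 2) ^ 2 := by linear_combination -t' ^ 2 * h2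
        _ = (t * v 1) ^ 2 + (t * v 2) ^ 2 := by rw [e1, e2]
        _ = t ^ 2 := by linear_combination t ^ 2 * h1
    exact this.ge
  · refine le_of_cs_eq k0 hk ht' ?_
    rw [← form_geod_left hp hv.1, ← h, form_geod_left hp hv'.1]

theorem geodDist_geod (hp : form k p p = 1) (hv : IsUnitTangent k p v) {t : ℝ}
    (hk : 0 < k → √k * |t| ≤ π) : geodDist k p (geod k p v t) = |t| := by
  rcases le_total 0 t with h | h
  · rw [abs_of_nonneg h] at *
    exact geodDist_geod_of_nonneg hp hv h hk
  · rw [abs_of_nonpos h] at *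
    rw [← neg_neg t, ← geod_neg, neg_neg]
    exact geodDist_geod_of_nonneg hp hv.neg (by linarith) hk

/-- On a sphere any two points are joined by a geodesic of length at most half a period. -/
theorem exists_geod_eq (hk : 0 < k) (hp : form k p p = 1) (hq : form k q q = 1)
    (hv : IsUnitTangent k p v) :
    ∃ w t, IsUnitTangent k p w ∧ 0 ≤ t ∧ √k * t ≤ π ∧ geod k p w t = q := by
  have hs := sqrt_pos.2 hk
  set c := form k p q with hc
  have hsum : k * ((q 1 - c * p 1) ^ 2 + (q 2 - c * p 2) ^ 2) + (q 0 - c * p 0) ^ 2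
      = 1 - c ^ 2 := by
    simp only [form] at hp hq hc
    linear_combination hq + c ^ 2 * hp + 2 * c * hc
  have hc1 : c ^ 2 ≤ 1 := by
    have : 0 ≤ k * ((q 1 - c * p 1) ^ 2 + (q 2 - c * p 2) ^ 2) := by positivity
    nlinarith [sq_nonneg (q 0 - c * p 0)]
  have hc2 := abs_le.1 ((sq_le_one_iff_abs_le_one c).1 hc1)
  set t := arccos c / √k with ht
  have hst : √k * t = arccos c := by rw [ht]; field_simp
  have ht0 : 0 ≤ t := div_nonneg (arccos_nonneg c) hs.le
  have htpi : √k * t ≤ π := hst ▸ arccos_le_pi c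
  have hcs : cs k t = c := by rw [cs, if_pos hk, hst, cos_arccos hc2.1 hc2.2]
  have hsn := cs_sq_add k t
  rw [hcs] at hsn
  -- Here `q = ± p`, the direction is not determined, and the given `v` serves.
  by_cases h0 : sn k t = 0
  · refine ⟨v, t, hv, ht0, htpi, ?_⟩
    have hc3 : c ^ 2 = 1 := by rw [h0] at hsn; linarith
    rw [hc3] at hsum
    have a1 : 0 ≤ k * (q 1 - c * p 1) ^ 2 := by positivity
    have a2 : 0 ≤ k * (q 2 - c * p 2) ^ 2 := by positivity
    have a0 := sq_nonneg (q 0 - c * p 0)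
    have b0 : (q 0 - c * p 0) ^ 2 = 0 := by nlinarith
    have b1 : k * (q 1 - c * p 1) ^ 2 = 0 := by nlinarith
    have b2 : k * (q 2 - c * p 2) ^ 2 = 0 := by nlinarith
    simp only [mul_eq_zero, hk.ne', false_or, pow_eq_zero_iff two_ne_zero] at b0 b1 b2
    ext i
    fin_cases i <;> simp [geod, h0, hcs] <;> linarith
  · refine ⟨(sn k t)⁻¹ • (q - c • p), t, ⟨?_, ?_⟩, ht0, htpi, ?_⟩
    · simp only [form] at hp hc
      simp only [IsTangent, Pi.smul_apply, Pi.sub_apply, smul_eq_mul]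
      linear_combination (sn k t)⁻¹ * (-hc - c * hp)
    · rw [metric_eq_form hk.ne', div_eq_one_iff_eq hk.ne']
      simp only [form, Pi.smul_apply, Pi.sub_apply, smul_eq_mul]
      have : k * sn k t ^ 2 = 1 - c ^ 2 := by linarith
      field_simp
      linarith
    · rw [geod, smul_smul, mul_inv_cancel₀ h0, hcs]
      simp

/-- The distance back to `p` from a point of a geodesic issuing from `p`. -/
theorem cs_of_geodDist_geod (hp : form k p p = 1) (hv : IsUnitTangent k p v) {t x : ℝ}
    (hx : |x| = geodDist k (geod k p v t) p) :
    cs k x = cs k t ∧ (0 < k → √k * |x| ≤ π) := by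
  obtain ⟨t', h1, h2, h3⟩ := exists_period_shift k t
  have hg : geod k p v t = geod k p v t' := by simp [geod, h1, h2]
  have := geodDist_geod (t := -t') (form_geod_self hp hv t')
    (isUnitTangent_geod_velocity hp hv t') (by simpa using h3)
  rw [geod_geod_neg, ← hg, ← hx, abs_neg] at this
  rw [← cs_abs, this, cs_abs]
  exact ⟨h1, h3⟩

end

/-! ## Circles -/

theorem stdPolar_eq (k ρ θ : ℝ) :
    stdPolar k ρ θ = ![cs k ρ, sn k ρ * cos θ, sn k ρ * sin θ] := by
  ext i
  fin_cases i <;> simp [stdPolar, polar, geod, rot]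

theorem hasDerivAt_vec3 {f g h : ℝ → ℝ} {f' g' h' t : ℝ} (hf : HasDerivAt f f' t)
    (hg : HasDerivAt g g' t) (hh : HasDerivAt h h' t) :
    HasDerivAt (fun t => ![f t, g t, h t]) ![f', g', h'] t := by
  rw [hasDerivAt_pi]
  intro i
  fin_cases i
  · exact hf
  · exact hg
  · exact hh

theorem deriv_stdPolar_angle (k ρ θ : ℝ) :
    deriv (stdPolar k ρ) θ = ![0, -(sn k ρ * sin θ), sn k ρ * cos θ] := by
  have h : stdPolar k ρ = fun θ => ![cs k ρ, sn k ρ * cos θ, sn k ρ * sin θ] :=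
    funext (stdPolar_eq k ρ)
  rw [h]
  refine (hasDerivAt_vec3 (hasDerivAt_const _ _) ?_ ((hasDerivAt_sin θ).const_mul _)).deriv
  exact ((hasDerivAt_cos θ).const_mul _).congr_deriv (by ring)

theorem deriv_stdPolar_radius (k ρ θ : ℝ) :
    deriv (fun t => stdPolar k t θ) ρ = ![-k * sn k ρ, cs k ρ * cos θ, cs k ρ * sin θ] := by
  simp only [stdPolar_eq]
  exact (hasDerivAt_vec3 (hasDerivAt_cs k ρ) ((hasDerivAt_sn k ρ).mul_const _)
    ((hasDerivAt_sn k ρ).mul_const _)).deriv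

theorem sn_nonneg {k t : ℝ} (ht : 0 ≤ t) (hk : 0 < k → √k * t < π) : 0 ≤ sn k t := by
  rcases ht.eq_or_lt with rfl | h
  · simp
  · exact (sn_pos h hk).le

theorem ell_of_nonneg {k r : ℝ} (hr : 0 ≤ r) (hk : 0 < k → √k * r < π) : ell k r = sn k r := by
  have h0 := sn_nonneg hr hk
  have h : ∀ θ, √(metric k (deriv (stdPolar k |r|) θ) (deriv (stdPolar k |r|) θ)) = sn k r := by
    intro θ
    rw [abs_of_nonneg hr, deriv_stdPolar_angle]
    refine (congrArg sqrt ?_).trans (sqrt_sq h0)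
    simp [metric]
    linear_combination sn k r ^ 2 * sin_sq_add_cos_sq θ
  simp only [ell, circumference, h, intervalIntegral.integral_const, smul_eq_mul, sub_zero]
  rcases hr.eq_or_lt with rfl | hpos
  · simp
  · rw [sign_of_pos hpos]
    field_simp [pi_ne_zero]

theorem geodesicCurvature_circle {k ρ : ℝ} (h : sn k ρ ≠ 0) :
    geodesicCurvature k (fun s => stdPolar k ρ (s / sn k ρ)) 0 = cs k ρ / sn k ρ := by
  set σ := sn k ρ with hσ
  have hd : ∀ s, HasDerivAt (fun s : ℝ => s / σ) (1 / σ) s := fun s =>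
    (hasDerivAt_id s).div_const σ
  have h1 : deriv (fun s => stdPolar k ρ (s / σ)) =
      fun s => ![0, -sin (s / σ), cos (s / σ)] := by
    funext s
    simp only [stdPolar_eq]
    refine (hasDerivAt_vec3 (hasDerivAt_const _ _) ?_ ?_).deriv
    · refine ((hd s).cos.const_mul _).congr_deriv ?_
      rw [← hσ]
      field_simp
    · refine ((hd s).sin.const_mul _).congr_deriv ?_
      rw [← hσ]
      field_simp
  have h2 : deriv (fun s => ![0, -sin (s / σ), cos (s / σ)]) 0 = ![0, -(1 / σ), 0] := by
    refine (hasDerivAt_vec3 (hasDerivAt_const _ _) ?_ ?_).deriv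
    · refine (hd 0).sin.neg.congr_deriv ?_
      simp
    · refine (hd 0).cos.congr_deriv ?_
      simp
  rw [geodesicCurvature, h1, h2]
  simp only [stdPolar_eq, tangentProj, rot, metric, Pi.sub_apply, Pi.smul_apply, smul_eq_mul,
    Matrix.cons_val]
  simp only [zero_div, sin_zero, cos_zero, ← hσ]
  by_cases hk : k = 0
  · subst hk; field_simp; simp
  · field_simp
    ring

/-- For `r ≠ 0` the factors are `± sn k |r|` and `± cs k r / sn k |r|` with the same sign; the bound
on `r` keeps `sn k |r|` positive. -/
theorem ellCurv_eq {k r : ℝ} (hk : 0 < k → √k * |r| < π) : ellCurv k r = cs k r := by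
  unfold ellCurv
  split_ifs with h
  · simp [h]
  · have hpos := abs_pos.2 h
    have hsn := sn_pos hpos hk
    have h1 : ell k r = Real.sign r * sn k |r| := by
      have := ell_of_nonneg hpos.le hk
      rw [← this]
      simp only [ell, circumference, abs_abs, sign_of_pos hpos]
      ring
    have hs : Real.sign r * Real.sign r = 1 := by
      rcases lt_or_gt_of_ne h with h' | h'
      · simp [sign_of_neg h']
      · simp [sign_of_pos h']
    rw [circleCurvature, ell_of_nonneg hpos.le hk, geodesicCurvature_circle hsn.ne', h1, cs_abs]
    field_simp
    linear_combination cs k r * hs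

/-- The area density is `sn k ρ`, and `-k * sn k` is the derivative of `cs k`. -/
theorem one_sub_area_eq {k r : ℝ} (hk : 0 < k → √k * |r| < π) :
    1 - k * area k r = cs k r := by
  have hdens : ∀ ρ ∈ Set.uIcc 0 |r|, ∀ θ, areaDensity k ρ θ = sn k ρ := by
    intro ρ hρ θ
    rw [Set.uIcc_of_le (abs_nonneg r)] at hρ
    have h0 : 0 ≤ sn k ρ := sn_nonneg hρ.1 fun h =>
      (mul_le_mul_of_nonneg_left hρ.2 (sqrt_nonneg k)).trans_lt (hk h)
    have hw : deriv (fun t => stdPolar k ρ t) θ = _ := deriv_stdPolar_angle k ρ θ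
    have h1 := cs_sq_add k ρ
    have h2 := sin_sq_add_cos_sq θ
    simp only [areaDensity, hw, deriv_stdPolar_radius]
    have hu : metric k ![-k * sn k ρ, cs k ρ * cos θ, cs k ρ * sin θ]
        ![-k * sn k ρ, cs k ρ * cos θ, cs k ρ * sin θ] = 1 := by
      simp only [metric, Matrix.cons_val]
      by_cases k0 : k = 0
      · subst k0
        simp only [zero_mul, neg_zero, div_zero]
        linear_combination cs 0 ρ ^ 2 * h2 + h1
      · field_simp
        linear_combination cs k ρ ^ 2 * h2 + h1
    rw [hu]
    refine (congrArg sqrt ?_).trans (sqrt_sq h0)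
    simp [metric]
    linear_combination sn k ρ ^ 2 * h2
  have hint : diskArea k r = 2 * π * ∫ ρ in (0 : ℝ)..|r|, sn k ρ := by
    rw [diskArea, ← intervalIntegral.integral_const_mul]
    refine intervalIntegral.integral_congr fun ρ hρ => ?_
    simp [hdens ρ hρ]
  have hcont : Continuous fun ρ => -k * sn k ρ :=
    continuous_const.mul (continuous_iff_continuousAt.2 fun t => (hasDerivAt_sn k t).continuousAt)
  have hftc := intervalIntegral.integral_eq_sub_of_hasDerivAt (a := 0) (b := |r|)
    (fun t _ => hasDerivAt_cs k t) (hcont.intervalIntegrable _ _)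
  rw [intervalIntegral.integral_const_mul, cs_zero, cs_abs] at hftc
  rw [area, hint, mul_div_cancel_left₀ _ two_pi_pos.ne']
  linarith

/-! ## Curves parametrized by arclength -/

section
variable {k : ℝ} {c : ℝ → Fin 3 → ℝ} {s : ℝ}

theorem hasDerivAt_coord {c' : Fin 3 → ℝ} (h : HasDerivAt c c' s) (i : Fin 3) :
    HasDerivAt (fun t => c t i) (c' i) s := hasDerivAt_pi.1 h i

theorem isTangent_deriv {c' : Fin 3 → ℝ} (hc : ∀ s, form k (c s) (c s) = 1)
    (h : HasDerivAt c c' s) : IsTangent k (c s) c' := by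
  have d := hasDerivAt_coord h
  have h1 := ((d 0).mul (d 0)).add ((((d 1).mul (d 1)).add ((d 2).mul (d 2))).const_mul k)
  have h2 : HasDerivAt (fun s => form k (c s) (c s)) _ s := h1
  simp only [hc] at h2
  have := h2.unique (hasDerivAt_const s (1 : ℝ))
  simp only [IsTangent]
  linarith

theorem metric_second_deriv {c' : ℝ → Fin 3 → ℝ} {c'' : Fin 3 → ℝ}
    (hu : ∀ s, metric k (c' s) (c' s) = 1) (h : HasDerivAt c' c'' s) :
    metric k c'' (c' s) = 0 := by
  have d := hasDerivAt_coord h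
  have h1 := (((d 1).mul (d 1)).add ((d 2).mul (d 2))).add (((d 0).mul (d 0)).div_const k)
  have h2 : HasDerivAt (fun s => metric k (c' s) (c' s)) _ s := h1
  simp only [hu] at h2
  have := h2.unique (hasDerivAt_const s (1 : ℝ))
  simp only [metric]
  linear_combination this / 2

theorem hasDerivAt_tripleProd {a b c' : Fin 3 → ℝ} (h : HasDerivAt c c' s) :
    HasDerivAt (fun t => tripleProd a b (c t)) (tripleProd a b c') s := by
  have d := hasDerivAt_coord h
  refine (((((d 2).const_mul (b 1)).sub ((d 1).const_mul (b 2))).const_mul (a 0)).sub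
    ((((d 2).const_mul (b 0)).sub ((d 0).const_mul (b 2))).const_mul (a 1))).add
    ((((d 1).const_mul (b 0)).sub ((d 0).const_mul (b 1))).const_mul (a 2)) |>.congr_deriv ?_
  simp only [tripleProd]

theorem hasDerivAt_metric {b c' : Fin 3 → ℝ} (h : HasDerivAt c c' s) :
    HasDerivAt (fun t => metric k (c t) b) (metric k c' b) s := by
  have d := hasDerivAt_coord h
  exact (((d 1).mul_const (b 1)).add ((d 2).mul_const (b 2))).add
    (((d 0).mul_const (b 0)).div_const k)

/-- In the product rule the term `rot k (v s) (v s)` vanishes. -/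
theorem hasDerivAt_rot {v : ℝ → Fin 3 → ℝ} {d : Fin 3 → ℝ} (h : HasDerivAt c (v s) s)
    (hv : HasDerivAt v d s) :
    HasDerivAt (fun t => rot k (c t) (v t)) (rot k (c s) d) s := by
  have e := hasDerivAt_coord h
  have f := hasDerivAt_coord hv
  refine hasDerivAt_vec3 ?_ ?_ ?_
  · exact ((((e 1).mul (f 2)).sub ((e 2).mul (f 1))).const_mul k).congr_deriv (by ring)
  · exact (((e 2).mul (f 0)).sub ((e 0).mul (f 2))).congr_deriv (by ring)
  · exact (((e 0).mul (f 1)).sub ((e 1).mul (f 0))).congr_deriv (by ring)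

end

/-! ## Support lines of bodies with smooth boundary -/

section
variable {k : ℝ} {K : Set (CurvPlane k)} {γ : ℝ → CurvPlane k}

instance : T2Space (CurvPlane k) :=
  inferInstanceAs (T2Space
    {p : Fin 3 → ℝ // p 0 ^ 2 + k * (p 1 ^ 2 + p 2 ^ 2) = 1 ∧ (k ≤ 0 → 0 < p 0)})

theorem IsPositiveBoundaryParam.mem (hK : IsConvexBody K) (hγ : IsPositiveBoundaryParam K γ)
    (s : ℝ) : γ s ∈ K := by
  have : γ s ∈ frontier K := hγ.range_eq ▸ Set.mem_range_self s
  exact hK.isCompact.isClosed.frontier_subset this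

theorem IsPositiveBoundaryParam.hasDerivAt (hγ : IsPositiveBoundaryParam K γ) (s : ℝ) :
    HasDerivAt (fun s => (γ s).coord) (deriv (fun s => (γ s).coord) s) s :=
  (hγ.contDiff.differentiable (by norm_num) s).hasDerivAt

theorem IsPositiveBoundaryParam.hasDerivAt_deriv (hγ : IsPositiveBoundaryParam K γ) (s : ℝ) :
    HasDerivAt (deriv fun s => (γ s).coord) (deriv (deriv fun s => (γ s).coord) s) s := by
  have h : ContDiff ℝ (1 + 1) (fun s => (γ s).coord) := by
    have := hγ.contDiff
    norm_num
    exact this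
  exact (((contDiff_succ_iff_deriv.1 h).2.2).differentiable (by norm_num) s).hasDerivAt

theorem IsPositiveBoundaryParam.isUnitTangent (hγ : IsPositiveBoundaryParam K γ) (s : ℝ) :
    IsUnitTangent k (γ s).coord (deriv (fun s => (γ s).coord) s) :=
  ⟨isTangent_deriv (fun s => (γ s).form_self) (hγ.hasDerivAt s), hγ.unit_speed s⟩

/-- The support direction at a boundary point is the velocity. -/
theorem IsSupportDirection.eq_deriv (hK : IsConvexBody K) (hγ : IsPositiveBoundaryParam K γ)
    {s : ℝ} {v : Fin 3 → ℝ} (hv : IsSupportDirection K (γ s) v) :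
    v = deriv (fun s => (γ s).coord) s := by
  obtain ⟨hu, -, hleft⟩ := hv
  simp only [det_eq_tripleProd] at hleft
  have hp := (γ s).form_self
  have hT := hγ.isUnitTangent s
  set P := (γ s).coord with hP
  set T := deriv (fun s => (γ s).coord) s with hTdef
  have hder : HasDerivAt (fun t => tripleProd P v (γ t).coord) (tripleProd P v T) s :=
    hasDerivAt_tripleProd (hγ.hasDerivAt s)
  -- The determinant is nonnegative on `K` and vanishes at `P`; its critical point at `s` makes `v`
  -- and `T` parallel.
  have hmin : IsLocalMin (fun t => tripleProd P v (γ t).coord) s := by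
    refine Eventually.of_forall fun t => ?_
    have h0 : tripleProd P v (γ s).coord = 0 := by
      rw [← hP]; simp only [tripleProd]; ring
    simp only [h0]
    exact hleft _ (hγ.mem hK t)
  have h0 : tripleProd P v T = 0 := hmin.hasDerivAt_eq_zero hder
  have h1 : tripleProd P T v = 0 := by
    rw [← neg_eq_zero, ← h0]; simp only [tripleProd]; ring
  have h2 := hu.1.eq_frame hp hT
  rw [h1, zero_smul, add_zero] at h2
  have hm : metric k v T * metric k v T = 1 := by
    have := hu.2
    nth_rewrite 1 [h2] at this
    rw [metric_smul_left, metric_comm (v := deriv _ _)] at this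
    exact this
  -- Now `v = ± T`. The sign is settled by an interior point of `K` on the inner normal, which must
  -- lie to the left of `v`.
  have hpos : 0 ≤ metric k v T := by
    have hsn : ∀ᶠ t in 𝓝[>] (0 : ℝ), √k * t < π := by
      have : Tendsto (fun t => √k * t) (𝓝[>] (0 : ℝ)) (𝓝 0) := by
        have : Tendsto (fun t => √k * t) (𝓝 (0 : ℝ)) (𝓝 (√k * 0)) :=
          (continuous_const.mul continuous_id).tendsto 0
        rw [mul_zero] at this
        exact this.mono_left nhdsWithin_le_nhds
      exact this.eventually_lt_const pi_pos
    obtain ⟨t, ⟨⟨z, hz, hzt⟩, ht⟩, ht0⟩ :=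
      ((hγ.positive s).and hsn |>.and self_mem_nhdsWithin).exists
    have h3 := hleft z (interior_subset hz)
    have h4 : tripleProd P v z.coord = sn k t * tripleProd P v (rot k P T) := by
      rw [hzt]; simp only [tripleProd, geod, Pi.add_apply, Pi.smul_apply, smul_eq_mul]; ring
    rw [h4, tripleProd_rot hp hu.1 hT.1] at h3
    exact (mul_nonneg_iff_of_pos_left (sn_pos ht0 fun _ => ht)).1 h3
  have : metric k v T = 1 := by nlinarith
  rw [h2, this, one_smul]

/-- The right triangle `O F P` in terms of the frame at `P`. -/
theorem IsSupportTriangle.frame {O : CurvPlane k} {e : Fin 3 → ℝ}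
    (he : IsUnitTangent k O.coord e) (hK : IsConvexBody K)
    (hemi : 0 < k → ∀ q ∈ K, geodDist k O.coord q.coord < π / (2 * √k))
    (hγ : IsPositiveBoundaryParam K γ) {s r ω x : ℝ}
    (h : IsSupportTriangle O e K (γ s) r ω x) :
    (∃ τ, polar k O.coord e r ω = geod k (γ s).coord (deriv (fun s => (γ s).coord) s) τ ∧
      (-k * sn k r) • O.coord + cs k r • (cos ω • e + sin ω • rot k O.coord e) =
        -rot k (γ s).coord (deriv (fun s => (γ s).coord) s) ∧ cs k x = cs k τ) ∧
      (0 < k → √k * |r| < π / 2) ∧ (0 < k → √k * |x| < π / 2) := by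
  obtain ⟨v, τ, hv, h1, h2, h3, h4, h5⟩ := h
  have hvT := hv.eq_deriv hK hγ
  subst hvT
  have hPK := hv.2.1
  have hp := (γ s).form_self
  have ho := O.form_self
  set P := (γ s).coord with hP
  set T := deriv (fun s => (γ s).coord) s with hTdef
  rw [(hasDerivAt_geod k P T τ).deriv, rot_geod,
    show (fun t => polar k O.coord e t ω) =
      geod k O.coord (cos ω • e + sin ω • rot k O.coord e) from rfl,
    (hasDerivAt_geod k _ _ r).deriv] at h5
  obtain ⟨hx1, hx2⟩ := cs_of_geodDist_geod hp hv.1 h4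
  have hr : 0 < k → √k * |r| < π / 2 := by
    intro hk
    have hs := sqrt_pos.2 hk
    -- `P` itself lies on the support line, so `|r| ≤ d(O, P)`.
    have := h2 0
    rw [geod_zero, ← h3] at this
    replace this := this.trans_lt (hemi hk _ hPK)
    calc √k * |r| < √k * (π / (2 * √k)) := by gcongr
      _ = π / 2 := by field_simp
  refine ⟨⟨τ, h1, h5, hx1⟩, hr, fun hk => lt_of_cs_pos hk (hx2 hk) ?_⟩
  rw [hx1]
  obtain ⟨w, t, hw, ht0, htpi, hwt⟩ := exists_geod_eq hk ho hp he
  have hd := geodDist_geod_of_nonneg ho hw ht0 fun _ => htpi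
  have hlt := hemi hk _ hPK
  rw [← hP, ← hwt, hd] at hlt
  have hs := sqrt_pos.2 hk
  have hct : 0 < cs k t := cs_pos fun _ => by
    rw [abs_of_nonneg ht0]
    calc √k * t < √k * (π / (2 * √k)) := by gcongr
      _ = π / 2 := by field_simp
  have hfo : form k O.coord P = cs k t := by
    rw [← hwt, form_geod_left ho hw.1]
  -- Pythagoras for the triangle `O F P`: solve the equations for `F` and for the radial velocity
  -- for `O`, then pair with `P`, which is orthogonal to `N`.
  have hfo2 : form k O.coord P = cs k r * cs k τ := by
    have e1 := congrArg (form k P) h1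
    have e2 := congrArg (form k P) h5
    rw [form_geod_left hp hv.1.1] at e1
    have hN : form k P (rot k P T) = 0 := isTangent_rot
    have hc := cs_sq_add k r
    simp only [polar, geod, form, Pi.add_apply, Pi.smul_apply, Pi.neg_apply, smul_eq_mul]
      at e1 e2 hN ⊢
    linear_combination cs k r * e1 - sn k r * e2 + sn k r * hN
      - (O.coord 0 * P 0 + k * (O.coord 1 * P 1 + O.coord 2 * P 2)) * hc
  rw [hfo2] at hfo
  rw [← hfo] at hct
  exact (mul_pos_iff_of_pos_left (cs_pos hr)).1 hct

end

/-! ## Central angles -/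

/-- A continuous angle with prescribed differentiable polar direction is differentiable. -/
theorem hasDerivAt_angle {ω ρ A B : ℝ → ℝ} {A' B' s : ℝ} (hω : ContinuousAt ω s)
    (hρ : ∀ t, 0 < ρ t) (hA : ∀ t, ρ t * cos (ω t) = A t) (hB : ∀ t, ρ t * sin (ω t) = B t)
    (hA' : HasDerivAt A A' s) (hB' : HasDerivAt B B' s) :
    HasDerivAt ω ((B' * cos (ω s) - A' * sin (ω s)) / ρ s) s := by
  set ω₀ := ω s with hω₀
  have hden : A s * cos ω₀ + B s * sin ω₀ = ρ s := by
    rw [← hA, ← hB]; linear_combination ρ s * cos_sq_add_sin_sq (ω s)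
  have hnum : B s * cos ω₀ - A s * sin ω₀ = 0 := by
    rw [← hA, ← hB]; ring
  -- Near `s`, `ω - ω₀` is the `arctan` of a quotient of combinations of `A` and `B`. The factor `ρ`
  -- cancels there, so no regularity of `ρ` is needed.
  have hder := (((hB'.mul_const (cos ω₀)).sub (hA'.mul_const (sin ω₀))).div
    ((hA'.mul_const (cos ω₀)).add (hB'.mul_const (sin ω₀)))
    (by simp only [Pi.add_apply]; rw [hden]; exact (hρ s).ne')).arctan.const_add ω₀
  refine (hder.congr_of_eventuallyEq ?_).congr_deriv ?_
  · have h1 : ∀ᶠ t in 𝓝 s, dist (ω t) ω₀ < π / 2 :=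
      hω.eventually (Metric.ball_mem_nhds _ (by positivity))
    filter_upwards [h1] with t ht
    rw [Real.dist_eq, abs_lt] at ht
    have hq : (B t * cos ω₀ - A t * sin ω₀) / (A t * cos ω₀ + B t * sin ω₀) =
        tan (ω t - ω₀) := by
      rw [tan_eq_sin_div_cos, sin_sub, cos_sub, ← hA, ← hB]
      refine Eq.trans ?_ (mul_div_mul_left _ _ (hρ t).ne')
      congr 1 <;> ring
    simp only [Pi.sub_apply, Pi.add_apply, Pi.div_apply]
    rw [hq, arctan_tan (by linarith) (by linarith)]
    ring
  · simp only [Pi.sub_apply, Pi.add_apply, Pi.div_apply]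
    rw [hden, hnum]
    have := (hρ s).ne'
    field_simp
    simp only [zero_mul, sub_zero]
    ring

section
variable {k : ℝ} {K : Set (CurvPlane k)} {γ : ℝ → CurvPlane k} {O : CurvPlane k}
  {e : Fin 3 → ℝ} {r ω x : ℝ → ℝ}

theorem hasDerivAt_centralAngle (he : IsUnitTangent k O.coord e) (hK : IsConvexBody K)
    (hemi : 0 < k → ∀ q ∈ K, geodDist k O.coord q.coord < π / (2 * √k))
    (hγ : IsPositiveBoundaryParam K γ)
    (htri : ∀ s, IsSupportTriangle O e K (γ s) (r s) (ω s) (x s)) (hω : Continuous ω) (s : ℝ) :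
    HasDerivAt ω (geodesicCurvature k (fun s => (γ s).coord) s * cs k (x s) / cs k (r s)) s := by
  have ho := O.form_self
  have hJe := he.rot ho
  -- The factor `k` matters: at `k = 0` the product of `O` with a tangent vector need not vanish
  -- under `metric`.
  have hk0 : ∀ w, IsTangent k O.coord w → k * metric k O.coord w = 0 := by
    intro w hw
    by_cases hk : k = 0
    · simp [hk]
    · rw [metric_eq_form hk]
      have : form k O.coord w = 0 := hw
      simp [this]
  have hJ := metric_rot_self ho he.1
  have hcos : ∀ t, cs k (r t) * cos (ω t) =
      -metric k (rot k (γ t).coord (deriv (fun s => (γ s).coord) t)) e := by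
    intro t
    obtain ⟨⟨τ, -, h, -⟩, -⟩ := (htri t).frame he hK hemi hγ
    have := congrArg (fun w => metric k w e) h
    simp only [metric_add_left, metric_smul_left, metric_neg_left, he.2, hJ] at this
    linear_combination this + sn k (r t) * hk0 e he.1
  have hsin : ∀ t, cs k (r t) * sin (ω t) =
      -metric k (rot k (γ t).coord (deriv (fun s => (γ s).coord) t)) (rot k O.coord e) := by
    intro t
    obtain ⟨⟨τ, -, h, -⟩, -⟩ := (htri t).frame he hK hemi hγ
    have := congrArg (fun w => metric k w (rot k O.coord e)) h
    simp only [metric_add_left, metric_smul_left, metric_neg_left, hJe.2,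
      metric_comm.trans hJ] at this
    linear_combination this + sn k (r t) * hk0 _ hJe.1
  have hN := hasDerivAt_rot (k := k) (hγ.hasDerivAt s) (hγ.hasDerivAt_deriv s)
  have hrpos : ∀ t, 0 < cs k (r t) := fun t =>
    cs_pos ((htri t).frame he hK hemi hγ).2.1
  refine (hasDerivAt_angle hω.continuousAt hrpos hcos hsin (hasDerivAt_metric hN).neg
    (hasDerivAt_metric hN).neg).congr_deriv ?_
  congr 1
  obtain ⟨⟨τ, h1, h2, h3⟩, -⟩ := (htri s).frame he hK hemi hγ
  have hp := (γ s).form_self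
  have hT := hγ.isUnitTangent s
  have hD := metric_second_deriv hγ.unit_speed (hγ.hasDerivAt_deriv s)
  have hD0 : k = 0 → deriv (deriv fun s => (γ s).coord) s 0 = 0 := by
    intro hk
    have hz : ∀ t, deriv (fun s => (γ s).coord) t 0 = 0 := fun t =>
      (hγ.isUnitTangent t).1.zero_of_curv_zero (γ t).form_self hk
    have := hasDerivAt_coord (hγ.hasDerivAt_deriv s) 0
    simp only [hz] at this
    exact this.unique (hasDerivAt_const s 0)
  rw [rot_eq_neg_curvature_smul hp hT hD0 hD, h3]
  change _ = metric k (tangentProj k (γ s).coord (deriv (deriv fun s => (γ s).coord) s))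
    (rot k (γ s).coord (deriv (fun s => (γ s).coord) s)) * cs k τ
  generalize metric k (tangentProj k (γ s).coord (deriv (deriv fun s => (γ s).coord) s))
    (rot k (γ s).coord (deriv (fun s => (γ s).coord) s)) = κ
  have hT0 := hT.1.zero_of_curv_zero hp
  have hvol := tripleProd_rot hp hT.1 hT.1
  rw [hT.2] at hvol
  generalize deriv (fun s => (γ s).coord) s = T at *
  set P := (γ s).coord
  set u := cos (ω s) • e + sin (ω s) • rot k O.coord e with hu
  set N := rot k P T with hNdef
  -- Both `O` and `u` are written in terms of `F` and `N`. The change of basis has determinant `-1`,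
  -- and `F` contributes only its `P` component `cs k τ`, since its other component is along `T`.
  have hOu : tripleProd O.coord u T = cs k τ := by
    have hc := cs_sq_add k (r s)
    have hF : geod k P T τ = cs k (r s) • O.coord + sn k (r s) • u := h1.symm
    have hO : O.coord = cs k (r s) • geod k P T τ + sn k (r s) • N := by
      rw [hF, ← neg_neg N, ← h2]
      ext i
      simp only [Pi.add_apply, Pi.smul_apply, Pi.neg_apply, smul_eq_mul]
      linear_combination -O.coord i * hc
    have hu' : u = -cs k (r s) • N + (k * sn k (r s)) • geod k P T τ := by
      rw [hF, neg_smul, ← smul_neg, ← h2]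
      ext i
      simp only [Pi.add_apply, Pi.smul_apply, smul_eq_mul]
      linear_combination -u i * hc
    rw [hO, hu']
    calc _ = (cs k (r s) ^ 2 + k * sn k (r s) ^ 2) * cs k τ * tripleProd P T N := by
          simp only [tripleProd, geod, Pi.add_apply, Pi.smul_apply, smul_eq_mul]; ring
      _ = cs k τ := by rw [hc, hvol]; ring
  have hrotu : metric k (rot k O.coord u) T = tripleProd O.coord u T := metric_rot hT0
  have hru : rot k O.coord u = cos (ω s) • rot k O.coord e - sin (ω s) • e := by
    have h4 : rot k O.coord u = cos (ω s) • rot k O.coord e +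
        sin (ω s) • rot k O.coord (rot k O.coord e) := by
      rw [hu]
      ext i
      fin_cases i <;> simp only [rot, Pi.add_apply, Pi.smul_apply, smul_eq_mul,
        Fin.zero_eta, Fin.mk_one, Fin.reduceFinMk, Matrix.cons_val] <;> ring
    rw [h4, rot_rot ho he.1, smul_neg, sub_eq_add_neg]
  rw [hru, hOu, sub_eq_add_neg, metric_add_left, metric_neg_left, metric_smul_left,
    metric_smul_left, metric_comm, metric_comm (v := e)] at hrotu
  simp only [metric_smul_left]
  linear_combination κ * hrotu

end

end ConstCurv

/-! ### The curvature formula in terms of circles -/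

open ConstCurv
theorem theorem5p1 (k : ℝ)
    -- the origin and the direction of the axis from which central angles are measured
    (O : CurvPlane k) (e : Fin 3 → ℝ) (he : IsUnitTangent k O.coord e)
    (K : Set (CurvPlane k)) (hK : IsConvexBody K)
    -- on a sphere, `K` lies in the open hemisphere centered at the origin
    (hemi : 0 < k → ∀ q ∈ K, geodDist k O.coord q.coord < π / (2 * √k))
    (γ : ℝ → CurvPlane k) (hγ : IsPositiveBoundaryParam K γ)
    (r ω x : ℝ → ℝ) (htri : ∀ s, IsSupportTriangle O e K (γ s) (r s) (ω s) (x s))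
    (hω : Continuous ω) (s : ℝ) :
    DifferentiableAt ℝ ω s ∧
    ellCurv k (x s) ≠ 0 ∧
    geodesicCurvature k (fun s => (γ s).coord) s
      = ellCurv k (r s) / ellCurv k (x s) * deriv ω s ∧
    1 - k * area k (x s) ≠ 0 ∧
    geodesicCurvature k (fun s => (γ s).coord) s
      = (1 - k * area k (r s)) / (1 - k * area k (x s)) * deriv ω s ∧
    (k = 1 → geodesicCurvature k (fun s => (γ s).coord) s
      = cos (r s) / cos (x s) * deriv ω s) ∧
    (k = -1 → geodesicCurvature k (fun s => (γ s).coord) s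
      = cosh (r s) / cosh (x s) * deriv ω s) ∧
    (k = 0 → geodesicCurvature k (fun s => (γ s).coord) s = deriv ω s) := by
  have hd := hasDerivAt_centralAngle he hK hemi hγ htri hω s
  obtain ⟨-, hr, hx⟩ := (htri s).frame he hK hemi hγ
  have hr0 := (cs_pos hr).ne'
  have hx0 := (cs_pos hx).ne'
  have hr' : 0 < k → √k * |r s| < π := fun h => (hr h).trans (by linarith [pi_pos])
  have hx' : 0 < k → √k * |x s| < π := fun h => (hx h).trans (by linarith [pi_pos])
  have hmain : geodesicCurvature k (fun s => (γ s).coord) s =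
      cs k (r s) / cs k (x s) * deriv ω s := by
    rw [hd.deriv]; field_simp
  rw [ellCurv_eq hr', ellCurv_eq hx', one_sub_area_eq hr', one_sub_area_eq hx']
  refine ⟨hd.differentiableAt, hx0, hmain, hx0, hmain, ?_, ?_, ?_⟩
  · rintro rfl
    simpa [cs] using hmain
  · rintro rfl
    simpa [cs, show ¬(0 : ℝ) < -1 by norm_num] using hmain
  · rintro rfl
    simpa [cs] using hmain
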